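/- Let $\mathcal{X}$ be a non-empty set (the state space) and let $\mathcal{F}\subseteq\mathcal{X}^{\mathcal{X}}$ be a non-empty class of evolution functions. For $T\in\mathbb{N}$ and a (possibly randomized) learner $\mathcal{A}$, which in each round $t\in\{1,\dots,T\}$ observes $x_{<t}=(x_0,\dots,x_{t-1})$ and outputs a (random) prediction $\mathcal{A}(x_{<t})\in\mathcal{X}$ of the next state $x_t$, define the expected Markovian regret $$\mathtt{R}^{\mathtt{MK}}_{\mathcal{A}}(T,\mathcal{F}):=\sup_{(x_0,\dots,x_T)\in\mathcal{X}^{T+1}}\left(\mathbb{E}\left[\sum_{t=1}^T\mathbf{1}\{\mathcal{A}(x_{<t})\neq x_t\}\right]-\inf_{f\in\mathcal{F}}\sum_{t=1}^T\mathbf{1}\{f(x_{t-1})\neq x_t\}\right),$$ the expectation being over the randomness of $\mathcal{A}$. Let $\mathtt{L}(\mathcal{F})\in\mathbb{N}\cup\{\infty\}$ be the Littlestone dimension of $\mathcal{F}$: the supremum of all $d\in\mathbb{N}$ for which there are node labels $\mathcal{T}_{t-1}:\{-1,1\}^{t-1}\to\mathcal{X}$ and edge labels $Y_t:\{-1,1\}^t\to\mathcal{X}$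 $(1\le t\le d)$ such that for every $\sigma\in\{-1,1\}^d$ there is $f_\sigma\in\mathcal{F}$ with, for all $t\in\{1,\dots,d\}$, $f_\sigma(\mathcal{T}_{t-1}(\sigma_1,\dots,\sigma_{t-1}))=Y_t(\sigma_1,\dots,\sigma_t)$ and $Y_t(\sigma_1,\dots,\sigma_{t-1},-1)\neq Y_t(\sigma_1,\dots,\sigma_{t-1},+1)$. Then for every $T$ the minimax regret $\inf_{\mathcal{A}}\mathtt{R}^{\mathtt{MK}}_{\mathcal{A}}(T,\mathcal{F})$, the infimum being over all randomized learners, satisfies $$\frac{\min\{\mathtt{L}(\mathcal{F}),T\}}{18}\le\inf_{\mathcal{A}}\mathtt{R}^{\mathtt{MK}}_{\mathcal{A}}(T,\mathcal{F})\le\mathtt{L}(\mathcal{F})+\sqrt{T\,\mathtt{L}(\mathcal{F})\log T}$$ (with $\log$ the natural logarithm; the upper bound is void if $\mathtt{L}(\mathcal{F})=\infty$, and the square root is read as $0$ for $T=0$), and, if $\mathcal{F}$ contains at least two functions, also $$\frac{\sqrt{T}}{16\sqrt{3}}\le\inf_{\mathcal{A}}\mathtt{R}^{\mathtt{MK}}_{\mathcal{A}}(T,\mathcal{F}).$$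 Moreover, $\mathcal{F}$ is agnostically learnable under Markovian regret, that is, $\inf_{\mathcal{A}}\mathtt{R}^{\mathtt{MK}}_{\mathcal{A}}(T,\mathcal{F})=o(T)$ as $T\to\infty$, if and only if $\mathtt{L}(\mathcal{F})<\infty$. -/

import Mathlib

open MeasureTheory Filter Asymptotics

universe u

namespace DynLearn

/-- A (possibly randomized) learner on the state space `X`: a probability space carrying its
internal randomness together with, for each observed history `(x 0, …, x (t-1))`, a random
prediction of the next state.  The only requirement is that "the prediction equals `x`" is an
event.  (Taking `Ω` in the universe of `X` is no restriction: the relevant information is the law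
of the random map from histories to states, which lives on `(t : ℕ) → (Fin t → X) → X`.) -/
structure Learner (X : Type u) where
  /-- sample space of the internal randomness -/
  Ω : Type u
  /-- the events -/
  mΩ : MeasurableSpace Ω
  /-- the law of the internal randomness -/
  μ : @Measure Ω mΩ
  prob : @IsProbabilityMeasure Ω mΩ μ
  /-- prediction after seeing the first `t` states -/
  predict : (t : ℕ) → (Fin t → X) → Ω → X
  measurableSet_predict : ∀ (t : ℕ) (h : Fin t → X) (x : X),
    @MeasurableSet Ω mΩ {ω | predict t h ω = x}

attribute [instance] Learner.mΩ Learner.prob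

section

variable {X : Type u}

open Classical in
/-- Number of mistakes in rounds `1, …, T` on the stream `x 0, x 1, …, x T` when the internal
randomness takes the value `ω`; in round `t + 1` the learner sees `x 0, …, x t` and predicts
`x (t + 1)`.  Only the entries `x 0, …, x T` of `x` matter. -/
noncomputable def Learner.loss (A : Learner X) (T : ℕ) (x : ℕ → X) (ω : A.Ω) : ℝ :=
  ∑ t ∈ Finset.range T,
    if A.predict (t + 1) (fun i : Fin (t + 1) => x i) ω ≠ x (t + 1) then 1 else 0

/-- Expected number of mistakes of the learner on the stream `x 0, …, x T`. -/
noncomputable def Learner.expectedLoss (A : Learner X) (T : ℕ) (x : ℕ → X) : ℝ :=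
  ∫ ω, A.loss T x ω ∂A.μ

open Classical in
/-- Number of one-step prediction errors of the evolution function `f` on `x 0, …, x T`. -/
noncomputable def markovLoss (f : X → X) (T : ℕ) (x : ℕ → X) : ℕ :=
  ∑ t ∈ Finset.range T, if f (x t) ≠ x (t + 1) then 1 else 0

/-- Loss of the best evolution function in hindsight
(a minimum of natural numbers when `F` is nonempty). -/
noncomputable def bestLoss (F : Set (X → X)) (T : ℕ) (x : ℕ → X) : ℕ :=
  ⨅ f : F, markovLoss f.1 T x

/-- Expected Markovian regret of the learner `A`: supremum over all streams. -/
noncomputable def markovRegret (A : Learner X) (F : Set (X → X)) (T : ℕ) : ℝ :=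
  ⨆ x : ℕ → X, (A.expectedLoss T x - (bestLoss F T x : ℝ))

/-- Minimax expected Markovian regret: infimum over all randomized learners
(which may be chosen depending on `T` and `F`). -/
noncomputable def minimaxRegret (F : Set (X → X)) (T : ℕ) : ℝ :=
  ⨅ A : Learner X, markovRegret A F T

/-- Agnostic learnability under Markovian regret. -/
def AgnosticLearnable (F : Set (X → X)) : Prop :=
  (fun T : ℕ => minimaxRegret F T) =o[atTop] (fun T : ℕ => (T : ℝ))

/-- The complete binary tree of depth `d` with node labels `node` is shattered by `F`.
`false` and `true` stand for `-1` and `+1`; a node at level `t < d` is labelled by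
`node t (σ 0, …, σ (t-1))` (only the levels `t < d` matter), and the edges leaving it are
labelled by `edge (t + 1) (σ 0, …, σ t)`. -/
def Shatters (F : Set (X → X)) (d : ℕ) (node : (t : ℕ) → (Fin t → Bool) → X) : Prop :=
  ∃ edge : (t : ℕ) → (Fin t → Bool) → X,
    ∀ σ : Fin d → Bool, ∃ f ∈ F, ∀ (t : ℕ) (ht : t < d),
      f (node t (fun i => σ (Fin.castLE ht.le i)))
          = edge (t + 1) (fun i => σ (Fin.castLE (Nat.succ_le_of_lt ht) i)) ∧
      edge (t + 1) (Fin.snoc (α := fun _ => Bool) (fun i => σ (Fin.castLE ht.le i)) false)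
        ≠ edge (t + 1) (Fin.snoc (α := fun _ => Bool) (fun i => σ (Fin.castLE ht.le i)) true)

/-- The Littlestone dimension: the largest depth of a shattered tree, `⊤` if unbounded. -/
noncomputable def littlestoneDim (F : Set (X → X)) : ℕ∞ :=
  ⨆ (d : ℕ) (_ : ∃ node : (t : ℕ) → (Fin t → Bool) → X, Shatters F d node), (d : ℕ∞)

/-! The suprema and infima above are of nonempty bounded sets of reals, and the expectation is of
an integrable function. -/

theorem Learner.loss_mem (A : Learner X) (T : ℕ) (x : ℕ → X) (ω : A.Ω) :
    0 ≤ A.loss T x ω ∧ A.loss T x ω ≤ T := by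
  constructor
  · exact Finset.sum_nonneg fun t _ => by split_ifs <;> norm_num
  · calc A.loss T x ω ≤ ∑ t ∈ Finset.range T, (1 : ℝ) :=
          Finset.sum_le_sum fun t _ => by split_ifs <;> norm_num
      _ = T := by simp

theorem Learner.measurable_loss (A : Learner X) (T : ℕ) (x : ℕ → X) :
    Measurable (A.loss T x) := by
  unfold Learner.loss
  refine Finset.measurable_sum _ fun t _ => Measurable.ite ?_ measurable_const measurable_const
  exact (A.measurableSet_predict _ _ _).compl

theorem Learner.integrable_loss (A : Learner X) (T : ℕ) (x : ℕ → X) :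
    Integrable (A.loss T x) A.μ := by
  refine Integrable.of_bound (A.measurable_loss T x).aestronglyMeasurable (T : ℝ) ?_
  refine Filter.Eventually.of_forall fun ω => ?_
  rw [Real.norm_eq_abs, abs_of_nonneg (A.loss_mem T x ω).1]
  exact (A.loss_mem T x ω).2

theorem Learner.expectedLoss_mem (A : Learner X) (T : ℕ) (x : ℕ → X) :
    0 ≤ A.expectedLoss T x ∧ A.expectedLoss T x ≤ T := by
  constructor
  · exact integral_nonneg fun ω => (A.loss_mem T x ω).1
  · calc A.expectedLoss T x ≤ ∫ _, (T : ℝ) ∂A.μ :=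
          integral_mono (A.integrable_loss T x) (integrable_const _) fun ω => (A.loss_mem T x ω).2
      _ = T := by simp

theorem bestLoss_le {F : Set (X → X)} {f : X → X} (hf : f ∈ F) (T : ℕ) (x : ℕ → X) :
    bestLoss F T x ≤ markovLoss f T x :=
  Nat.sInf_le ⟨⟨f, hf⟩, rfl⟩

theorem markovLoss_le (f : X → X) (T : ℕ) (x : ℕ → X) : markovLoss f T x ≤ T := by
  calc markovLoss f T x ≤ ∑ t ∈ Finset.range T, 1 :=
        Finset.sum_le_sum fun t _ => by split_ifs <;> norm_num
    _ = T := by simp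

theorem bddAbove_regret (A : Learner X) (F : Set (X → X)) (T : ℕ) :
    BddAbove (Set.range fun x : ℕ → X => A.expectedLoss T x - (bestLoss F T x : ℝ)) := by
  refine ⟨T, ?_⟩
  rintro _ ⟨x, rfl⟩
  have h1 := (A.expectedLoss_mem T x).2
  have h2 : (0 : ℝ) ≤ bestLoss F T x := Nat.cast_nonneg _
  simp only
  linarith

theorem bddBelow_markovRegret [Nonempty X] {F : Set (X → X)} (hF : F.Nonempty) (T : ℕ) :
    BddBelow (Set.range fun A : Learner X => markovRegret A F T) := by
  refine ⟨-T, ?_⟩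
  rintro _ ⟨A, rfl⟩
  obtain ⟨f, hf⟩ := hF
  let x : ℕ → X := fun _ => Classical.arbitrary X
  have h1 := (A.expectedLoss_mem T x).1
  have h2 : (bestLoss F T x : ℝ) ≤ T := by
    exact_mod_cast (bestLoss_le hf T x).trans (markovLoss_le f T x)
  refine le_trans ?_ (le_ciSup (bddAbove_regret A F T) x)
  linarith

instance [Nonempty X] : Nonempty (Learner X) :=
  ⟨{ Ω := PUnit
     mΩ := ⊤
     μ := @Measure.dirac PUnit ⊤ PUnit.unit
     prob := @Measure.dirac.isProbabilityMeasure PUnit ⊤ PUnit.unit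
     predict := fun _ _ _ => Classical.arbitrary X
     measurableSet_predict := fun _ _ _ => MeasurableSpace.measurableSet_top }⟩

end

end DynLearn

/-!
Both lower bounds come from adversaries that play against the error probabilities of the learner.
These are numbers attached to a stream (`Learner.missProb`), and among `k` distinct candidates for
the next state they add up to at least `k - 1`.  The adversary can therefore be deterministic:
whenever a random move would do, one of its outcomes does at least as well.

*Littlestone dimension from below.*  At a state where the class splits into two subclasses with deep
trees, moving to one of the two labels makes the learner err with probability `1 / 2` at no cost to
the comparator.  The comparator is uncontrolled at the state so reached, and going from there to the
next node of the tree may cost it `1`.  The adversary gives away two levels of the tree and goes to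
one of three distinct nodes on a branch, so that the learner errs there with probability `2 / 3`.
Jump and split together yield `2 / 3 - 1 + 1 / 2 = 1 / 6` for three levels and two rounds
(`Learner.exists_gain_of_hasTree`), and hence `min L T / 18`.

*Square root from below.*  Let `f`, `g` in the class differ at `x₀`.  Consider the walk that moves to
`f s` or `g s` with probability `1 / 2` each where these differ, and otherwise to the common value or
back to `x₀`.  The learner loses at least the average of the losses of `f` and `g`, so the regret is
at least half the expected absolute difference `D` of these losses.  As `D` is a martingale that
moves in at least a third of the rounds on average, its second and fourth moments give `√T / 18`.  The bound is
carried through a backward induction by a polynomial potential (`walkPotential`,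
`Learner.exists_le_gain_pair`).

*Upper bound.*  An expert is a set of at most `d` rounds in which the standard optimal algorithm is
allowed to update.  For every `f` in the class some expert makes at most `d` mistakes beyond those of
`f` (`exists_update_rounds`).  Exponential weights over the at most `(T + 1) ^ d` experts
(`exists_learner_le_expert`) cost a further `√(T / 2 * d * log (T + 1))`, and
`log (T + 1) ≤ 2 * log T` for `T ≥ 2`.

Trees are handled through the recursive predicate `HasTree`, equivalent to `Shatters`.
-/

namespace DynLearn

variable {X : Type u}

/-! ### Littlestone trees by recursion -/

/-- `HasTree d V` says that the class `V` shatters a complete binary tree of depth `d`, by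
recursion on the root: some state `x` and two labels `y ≠ z` such that both subclasses
`{f ∈ V | f x = y}` and `{f ∈ V | f x = z}` shatter a tree of depth `d - 1`. -/
def HasTree : ℕ → Set (X → X) → Prop
  | 0, V => V.Nonempty
  | d + 1, V => ∃ x y z : X, y ≠ z ∧ HasTree d {f ∈ V | f x = y} ∧ HasTree d {f ∈ V | f x = z}

theorem HasTree.mono {d : ℕ} {V W : Set (X → X)} (h : HasTree d V) (hVW : V ⊆ W) :
    HasTree d W := by
  induction d generalizing V W with
  | zero => exact Set.Nonempty.mono hVW h
  | succ d ih =>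
    obtain ⟨x, y, z, hyz, hy, hz⟩ := h
    exact ⟨x, y, z, hyz, ih hy fun f hf => ⟨hVW hf.1, hf.2⟩, ih hz fun f hf => ⟨hVW hf.1, hf.2⟩⟩

theorem HasTree.pred {d : ℕ} {V : Set (X → X)} (h : HasTree (d + 1) V) : HasTree d V := by
  obtain ⟨x, y, z, -, hy, -⟩ := h
  exact hy.mono fun f hf => hf.1

theorem HasTree.of_le {d e : ℕ} {V : Set (X → X)} (h : HasTree e V) (hde : d ≤ e) :
    HasTree d V := by
  induction e, hde using Nat.le_induction with
  | base => exact h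
  | succ e _ ih => exact ih h.pred

theorem HasTree.nonempty {d : ℕ} {V : Set (X → X)} (h : HasTree d V) : V.Nonempty :=
  h.of_le (Nat.zero_le d)

theorem snoc_cons {t : ℕ} (b c : Bool) (τ : Fin t → Bool) :
    (Fin.snoc (α := fun _ => Bool) (Fin.cons (α := fun _ => Bool) b τ) c : Fin (t + 2) → Bool) =
      Fin.cons (α := fun _ => Bool) b (Fin.snoc (α := fun _ => Bool) τ c) :=
  (Fin.cons_snoc_eq_snoc_cons b τ c).symm

theorem castLE_cons {t d : ℕ} (h : t ≤ d) (b : Bool) (τ : Fin d → Bool) :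
    (fun i : Fin (t + 1) =>
        (Fin.cons (α := fun _ => Bool) b τ : Fin (d + 1) → Bool)
          (Fin.castLE (Nat.succ_le_succ h) i)) =
      Fin.cons (α := fun _ => Bool) b (fun i => τ (Fin.castLE h i)) := by
  funext i
  refine Fin.cases rfl (fun j => rfl) i

/-- The two subtrees below the root of a tree given by path-indexed labels are obtained by prefixing
the first direction to every path. -/
theorem HasTree.of_shatters {d : ℕ} {V : Set (X → X)} {node : (t : ℕ) → (Fin t → Bool) → X}
    (h : Shatters V d node) : HasTree d V := by
  induction d generalizing V node with
  | zero =>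
    obtain ⟨edge, h⟩ := h
    obtain ⟨f, hf, -⟩ := h Fin.elim0
    exact ⟨f, hf⟩
  | succ d ih =>
    obtain ⟨edge, h⟩ := h
    have hnode : ∀ s s' : Fin 0 → Bool, node 0 s = node 0 s' := fun s s' => by
      rw [Subsingleton.elim s s']
    have hedge : ∀ (s : Fin 1 → Bool) (b : Bool), s 0 = b → edge 1 s = edge 1 (fun _ => b) := by
      rintro s b rfl
      congr 1
      funext i
      rw [Subsingleton.elim i 0]
    have key : ∀ b : Bool, HasTree d {f ∈ V | f (node 0 Fin.elim0) = edge 1 (fun _ => b)} := by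
      intro b
      refine ih (node := fun t τ => node (t + 1) (Fin.cons (α := fun _ => Bool) b τ))
        ⟨fun t τ => edge (t + 1) (Fin.cons (α := fun _ => Bool) b τ), fun τ => ?_⟩
      obtain ⟨f, hf, hft⟩ := h (Fin.cons (α := fun _ => Bool) b τ)
      refine ⟨f, ⟨hf, ?_⟩, fun t ht => ?_⟩
      · have h0 := (hft 0 (Nat.succ_pos d)).1
        rw [hnode _ Fin.elim0, hedge _ b rfl] at h0
        exact h0
      · have h1 := hft (t + 1) (Nat.succ_lt_succ ht)
        rw [castLE_cons ht.le, castLE_cons (Nat.succ_le_of_lt ht), snoc_cons, snoc_cons] at h1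
        exact h1
    refine ⟨_, _, _, ?_, key false, key true⟩
    obtain ⟨f, -, hft⟩ := h (fun _ => false)
    have h0 := (hft 0 (Nat.succ_pos d)).2
    rw [hedge _ false (Fin.snoc_last (α := fun _ => Bool) _ _),
      hedge _ true (Fin.snoc_last (α := fun _ => Bool) _ _)] at h0
    exact h0

theorem HasTree.exists_shatters [Nonempty X] {d : ℕ} {V : Set (X → X)} (h : HasTree d V) :
    ∃ node : (t : ℕ) → (Fin t → Bool) → X, Shatters V d node := by
  induction d generalizing V with
  | zero =>
    obtain ⟨f, hf⟩ := h
    obtain ⟨x⟩ := ‹Nonempty X›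
    exact ⟨fun _ _ => x, fun _ _ => x, fun _ => ⟨f, hf, fun t ht => absurd ht t.not_lt_zero⟩⟩
  | succ d ih =>
    obtain ⟨x, y, z, hyz, hy, hz⟩ := h
    obtain ⟨N₀, E₀, h₀⟩ := ih hy
    obtain ⟨N₁, E₁, h₁⟩ := ih hz
    refine ⟨fun t => match t with
      | 0 => fun _ => x
      | t + 1 => fun σ => bif σ 0 then N₁ t (Fin.tail σ) else N₀ t (Fin.tail σ),
      fun t => match t with
      | 0 => fun _ => x
      | 1 => fun σ => bif σ 0 then z else y
      | t + 2 => fun σ => bif σ 0 then E₁ (t + 1) (Fin.tail σ) else E₀ (t + 1) (Fin.tail σ),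
      fun σ => ?_⟩
    obtain ⟨b, τ, rfl⟩ : ∃ b τ, σ = Fin.cons (α := fun _ => Bool) b τ :=
      ⟨σ 0, Fin.tail σ, (Fin.cons_self_tail (α := fun _ => Bool) σ).symm⟩
    have hroot : ∀ (s : Fin 0 → Bool) (c : Bool),
        (Fin.snoc (α := fun _ => Bool) s c : Fin 1 → Bool) 0 = c := fun s c =>
      Fin.snoc_last (α := fun _ => Bool) c s
    cases b
    · obtain ⟨f, hf, hft⟩ := h₀ τ
      refine ⟨f, hf.1, fun t ht => ?_⟩
      cases t with
      | zero => simpa [hroot] using ⟨hf.2, hyz⟩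
      | succ t =>
        have ht' := Nat.lt_of_succ_lt_succ ht
        rw [castLE_cons ht'.le, castLE_cons (Nat.succ_le_of_lt ht'), snoc_cons, snoc_cons]
        simpa using hft t ht'
    · obtain ⟨f, hf, hft⟩ := h₁ τ
      refine ⟨f, hf.1, fun t ht => ?_⟩
      cases t with
      | zero => simpa [hroot] using ⟨hf.2, hyz⟩
      | succ t =>
        have ht' := Nat.lt_of_succ_lt_succ ht
        rw [castLE_cons ht'.le, castLE_cons (Nat.succ_le_of_lt ht'), snoc_cons, snoc_cons]
        simpa using hft t ht'

/-- The supremum defining a finite `littlestoneDim` is attained, and trees can be truncated; depth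
`0` is separate because a supremum `0` says nothing about `V` being nonempty. -/
theorem hasTree_of_le_littlestoneDim {V : Set (X → X)} (hV : V.Nonempty) {d : ℕ}
    (hd : (d : ℕ∞) ≤ littlestoneDim V) : HasTree d V := by
  rcases Nat.eq_zero_or_pos d with rfl | hpos
  · exact hV
  by_contra hcon
  have : littlestoneDim V ≤ ((d - 1 : ℕ) : ℕ∞) := by
    refine iSup₂_le fun e he => ?_
    obtain ⟨node, hnode⟩ := he
    have h1 := HasTree.of_shatters hnode
    by_contra hlt
    rw [not_le, Nat.cast_lt] at hlt
    exact hcon (h1.of_le (by omega))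
  have h2 := hd.trans this
  rw [Nat.cast_le] at h2
  omega

theorem HasTree.le_littlestoneDim [Nonempty X] {V : Set (X → X)} {d : ℕ} (h : HasTree d V) :
    (d : ℕ∞) ≤ littlestoneDim V :=
  le_iSup₂_of_le d h.exists_shatters le_rfl

/-! ### Regret of a learner along a stream, and the lower bound from the tree -/

/-- Probability that the learner errs in round `t + 1` on the stream `x`.  A function of the stream
with one value per round, it makes the expected loss a sum over rounds. -/
noncomputable def Learner.missProb (A : Learner X) (x : ℕ → X) (t : ℕ) : ℝ :=
  A.μ.real {ω | A.predict (t + 1) (fun i : Fin (t + 1) => x i) ω ≠ x (t + 1)}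

open Classical in
/-- One-step error of the evolution function `f` in round `t + 1` on the stream `x`. -/
noncomputable def stepLoss (f : X → X) (x : ℕ → X) (t : ℕ) : ℝ :=
  if f (x t) ≠ x (t + 1) then 1 else 0

theorem stepLoss_of_eq {f : X → X} {x : ℕ → X} {t : ℕ} (h : f (x t) = x (t + 1)) :
    stepLoss f x t = 0 := by simp [stepLoss, h]

theorem stepLoss_of_ne {f : X → X} {x : ℕ → X} {t : ℕ} (h : f (x t) ≠ x (t + 1)) :
    stepLoss f x t = 1 := by simp [stepLoss, h]

theorem stepLoss_le_one (f : X → X) (x : ℕ → X) (t : ℕ) : stepLoss f x t ≤ 1 := by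
  unfold stepLoss; split_ifs <;> norm_num

theorem Learner.missProb_nonneg (A : Learner X) (x : ℕ → X) (t : ℕ) : 0 ≤ A.missProb x t :=
  measureReal_nonneg

theorem markovLoss_eq_sum (f : X → X) (T : ℕ) (x : ℕ → X) :
    (markovLoss f T x : ℝ) = ∑ t ∈ Finset.range T, stepLoss f x t := by
  simp [markovLoss, stepLoss]

theorem Learner.expectedLoss_eq_sum (A : Learner X) (T : ℕ) (x : ℕ → X) :
    A.expectedLoss T x = ∑ t ∈ Finset.range T, A.missProb x t := by
  classical
  have hm : ∀ t, MeasurableSet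
      {ω | A.predict (t + 1) (fun i : Fin (t + 1) => x i) ω ≠ x (t + 1)} := fun t =>
    (A.measurableSet_predict _ _ _).compl
  have hind : ∀ ω t, (if A.predict (t + 1) (fun i : Fin (t + 1) => x i) ω ≠ x (t + 1)
      then (1 : ℝ) else 0) = Set.indicator
        {ω | A.predict (t + 1) (fun i : Fin (t + 1) => x i) ω ≠ x (t + 1)} 1 ω := fun ω t => by
    simp [Set.indicator_apply]
  unfold Learner.expectedLoss Learner.loss
  simp only [hind]
  rw [integral_finsetSum]
  · exact Finset.sum_congr rfl fun t _ => integral_indicator_one (hm t)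
  · exact fun t _ => (integrable_const (1 : ℝ)).indicator (hm t)

/-- The error probability in round `t + 1` depends on the first `t + 2` states only. -/
theorem Learner.missProb_congr (A : Learner X) {x x' : ℕ → X} {t : ℕ}
    (h : ∀ i ≤ t + 1, x i = x' i) : A.missProb x t = A.missProb x' t := by
  have : (fun i : Fin (t + 1) => x i) = fun i : Fin (t + 1) => x' i :=
    funext fun i => h i (by omega)
  rw [Learner.missProb, Learner.missProb, this, h (t + 1) le_rfl]

theorem stepLoss_congr (f : X → X) {x x' : ℕ → X} {t : ℕ}
    (h : ∀ i ≤ t + 1, x i = x' i) : stepLoss f x t = stepLoss f x' t := by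
  rw [stepLoss, stepLoss, h t (Nat.le_succ t), h (t + 1) le_rfl]

/-- The stream `x` with its state at time `n + 1` replaced by `a`. -/
noncomputable def extend (x : ℕ → X) (n : ℕ) (a : X) : ℕ → X := Function.update x (n + 1) a

@[simp] theorem extend_succ (x : ℕ → X) (n : ℕ) (a : X) : extend x n a (n + 1) = a := by
  simp [extend]

theorem extend_of_le (x : ℕ → X) {n i : ℕ} (a : X) (h : i ≤ n) : extend x n a i = x i := by
  have : i ≠ n + 1 := by omega
  simp [extend, this]

@[simp] theorem extend_self (x : ℕ → X) (n : ℕ) (a : X) : extend x n a n = x n :=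
  extend_of_le x a le_rfl

theorem Learner.missProb_extend (A : Learner X) (x : ℕ → X) (n : ℕ) (a : X) :
    A.missProb (extend x n a) n =
      A.μ.real {ω | A.predict (n + 1) (fun i : Fin (n + 1) => x i) ω ≠ a} := by
  have : (fun i : Fin (n + 1) => extend x n a i) = fun i : Fin (n + 1) => x i :=
    funext fun i => extend_of_le x a (by omega)
  rw [Learner.missProb, this, extend_succ]

/-- The events that the prediction equals a given candidate are disjoint for distinct candidates, so
the probabilities of a correct prediction add up to at most `1`. -/
theorem Learner.card_sub_one_le_sum_missProb (A : Learner X) (x : ℕ → X) (n : ℕ) (S : Finset X) :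
    (S.card : ℝ) - 1 ≤ ∑ a ∈ S, A.missProb (extend x n a) n := by
  set P := A.predict (n + 1) (fun i : Fin (n + 1) => x i) with hP
  have h1 : ∀ a ∈ S, A.missProb (extend x n a) n = 1 - A.μ.real {ω | P ω = a} := fun a _ => by
    rw [A.missProb_extend]
    exact probReal_compl_eq_one_sub (A.measurableSet_predict _ _ a)
  have h2 : ∑ a ∈ S, A.μ.real {ω | P ω = a} = A.μ.real (⋃ a ∈ S, {ω | P ω = a}) := by
    rw [measureReal_biUnion_finset]
    · intro a _ b _ hab
      exact Set.disjoint_left.2 fun ω ha hb => hab (ha.symm.trans hb)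
    · exact fun a _ => A.measurableSet_predict _ _ a
  rw [Finset.sum_congr rfl h1, Finset.sum_sub_distrib, h2]
  have := measureReal_le_one (μ := A.μ) (s := ⋃ a ∈ S, {ω | P ω = a})
  simp only [Finset.sum_const, nsmul_eq_mul, mul_one]
  linarith

theorem Learner.one_le_missProb_add (A : Learner X) (x : ℕ → X) (n : ℕ) {a b : X} (hab : a ≠ b) :
    1 ≤ A.missProb (extend x n a) n + A.missProb (extend x n b) n := by
  classical
  have h := A.card_sub_one_le_sum_missProb x n {a, b}
  rw [Finset.card_pair hab, Finset.sum_pair hab] at h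
  norm_num at h
  exact h

/-- Regret of the learner against `f` in the rounds `n + 1, …, T` on the stream `x`. -/
noncomputable def Learner.gain (A : Learner X) (f : X → X) (x : ℕ → X) (n T : ℕ) : ℝ :=
  ∑ t ∈ Finset.Ico n T, (A.missProb x t - stepLoss f x t)

/-- The first round of `gain` split off, for a stream `x'` that continues `extend x n a`. -/
theorem Learner.gain_eq_add (A : Learner X) (f : X → X) {x x' : ℕ → X} {n T : ℕ} {a : X}
    (hn : n < T) (h : ∀ i ≤ n + 1, x' i = extend x n a i) :
    A.gain f x' n T = A.missProb (extend x n a) n - stepLoss f (extend x n a) n +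
      A.gain f x' (n + 1) T := by
  rw [Learner.gain, Finset.sum_eq_sum_Ico_succ_bot hn, A.missProb_congr h, stepLoss_congr f h,
    Learner.gain]

theorem eq_of_extend {x x' : ℕ → X} {n : ℕ} {a : X} (h : ∀ i ≤ n + 1, x' i = extend x n a i) :
    ∀ i ≤ n, x' i = x i := fun i hi =>
  (h i (Nat.le_succ_of_le hi)).trans (extend_of_le x a hi)

/-- Following the orbit of `f` costs `f` nothing. -/
theorem Learner.exists_gain_nonneg (A : Learner X) (f : X → X) {n T : ℕ} (hn : n ≤ T)
    (x : ℕ → X) : ∃ x' : ℕ → X, (∀ i ≤ n, x' i = x i) ∧ 0 ≤ A.gain f x' n T := by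
  induction hn using Nat.decreasingInduction generalizing x with
  | self => exact ⟨x, fun _ _ => rfl, by simp [Learner.gain]⟩
  | of_succ n hn ih =>
    obtain ⟨x', hx', hg⟩ := ih (extend x n (f (x n)))
    refine ⟨x', eq_of_extend hx', ?_⟩
    rw [A.gain_eq_add f hn hx', stepLoss_of_eq (by simp)]
    linarith [A.missProb_nonneg (extend x n (f (x n))) n]

/-- At a state where the class splits, the adversary can move so that the learner errs with
probability at least `1 / 2` while the comparator does not err. -/
theorem Learner.exists_gain_split (A : Learner X) {V : Set (X → X)} {n T : ℕ} (hn : n < T)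
    (x : ℕ → X) {y z : X} (hyz : y ≠ z) {c : ℝ}
    (H : ∀ a, a = y ∨ a = z → ∃ x' : ℕ → X, (∀ i ≤ n + 1, x' i = extend x n a i) ∧
      ∃ f ∈ V, f (x n) = a ∧ c ≤ A.gain f x' (n + 1) T) :
    ∃ x' : ℕ → X, (∀ i ≤ n, x' i = x i) ∧ ∃ f ∈ V, 1 / 2 + c ≤ A.gain f x' n T := by
  obtain ⟨a, ha, hmiss⟩ : ∃ a, (a = y ∨ a = z) ∧ 1 / 2 ≤ A.missProb (extend x n a) n := by
    by_contra! hcon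
    linarith [A.one_le_missProb_add x n hyz, hcon y (Or.inl rfl), hcon z (Or.inr rfl)]
  obtain ⟨x', hx', f, hf, hfa, hg⟩ := H a ha
  refine ⟨x', eq_of_extend hx', f, hf, ?_⟩
  rw [A.gain_eq_add f hn hx', stepLoss_of_eq (by simpa using hfa)]
  linarith

/-- Along one branch of a tree of depth `d + 3`, three distinct states occur at which the class
splits into two subclasses that still have trees of depth `d`. -/
theorem HasTree.exists_three_nodes {d : ℕ} {V : Set (X → X)} (h : HasTree (d + 3) V) :
    ∃ S : Finset X, S.card = 3 ∧ ∀ s ∈ S, ∃ y z, y ≠ z ∧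
      HasTree d {f ∈ V | f s = y} ∧ HasTree d {f ∈ V | f s = z} := by
  classical
  obtain ⟨x₁, y₁, z₁, h₁, hy₁, hz₁⟩ := h
  obtain ⟨x₂, y₂, z₂, h₂, hy₂, hz₂⟩ := id hy₁
  obtain ⟨x₃, y₃, z₃, h₃, hy₃, hz₃⟩ := id hy₂
  -- A function class that is constant at a state does not split there.
  have ne : ∀ {W : Set (X → X)} {s w y z : X} {k l : ℕ} {t : X}, (∀ f ∈ W, f s = w) → y ≠ z →
      HasTree k {f ∈ W | f t = y} → HasTree l {f ∈ W | f t = z} → s ≠ t := by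
    rintro W s w y z k l t hW hyz hy hz rfl
    obtain ⟨f, hf, hfy⟩ := hy.nonempty
    obtain ⟨g, hg, hgz⟩ := hz.nonempty
    exact hyz (by rw [← hfy, ← hgz, hW f hf, hW g hg])
  have h12 : x₁ ≠ x₂ := ne (fun f hf => hf.2) h₂ hy₂ hz₂
  have h13 : x₁ ≠ x₃ := ne (fun f hf => hf.1.2) h₃ hy₃ hz₃
  have h23 : x₂ ≠ x₃ := ne (fun f hf => hf.2) h₃ hy₃ hz₃
  refine ⟨{x₁, x₂, x₃}, Finset.card_eq_three.2 ⟨_, _, _, h12, h13, h23, rfl⟩, fun s hs => ?_⟩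
  simp only [Finset.mem_insert, Finset.mem_singleton] at hs
  rcases hs with rfl | rfl | rfl
  · exact ⟨y₁, z₁, h₁, hy₁.of_le (by omega), hz₁.of_le (by omega)⟩
  · exact ⟨y₂, z₂, h₂, (hy₂.of_le (by omega)).mono fun f hf => ⟨hf.1.1, hf.2⟩,
      (hz₂.of_le (by omega)).mono fun f hf => ⟨hf.1.1, hf.2⟩⟩
  · exact ⟨y₃, z₃, h₃, hy₃.mono fun f hf => ⟨hf.1.1.1, hf.2⟩,
      hz₃.mono fun f hf => ⟨hf.1.1.1, hf.2⟩⟩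

/-- From an arbitrary state, three levels of the tree buy the adversary a regret of `1 / 6` in two
rounds: jump to one of three nodes (the learner errs with probability at least `2 / 3`, the
comparator loses at most `1`), then split there. -/
theorem Learner.exists_gain_of_hasTree (A : Learner X) {T : ℕ} (k : ℕ) {V : Set (X → X)}
    (hV : HasTree (3 * k) V) {n : ℕ} (hn : n + 2 * k ≤ T) (x : ℕ → X) :
    ∃ x' : ℕ → X, (∀ i ≤ n, x' i = x i) ∧ ∃ f ∈ V, (k : ℝ) / 6 ≤ A.gain f x' n T := by
  induction k generalizing V n x with
  | zero =>
    obtain ⟨f, hf⟩ := hV.nonempty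
    obtain ⟨x', hx', hg⟩ := A.exists_gain_nonneg f (by omega) x
    exact ⟨x', hx', f, hf, by simpa using hg⟩
  | succ k ih =>
    obtain ⟨S, hS, hnode⟩ := HasTree.exists_three_nodes (d := 3 * k) hV
    obtain ⟨s, hs, hmiss⟩ : ∃ s ∈ S, 2 / 3 ≤ A.missProb (extend x n s) n := by
      by_contra! hcon
      have h1 := A.card_sub_one_le_sum_missProb x n S
      have h2 := Finset.sum_lt_sum_of_nonempty (Finset.card_pos.1 (by omega)) hcon
      rw [Finset.sum_const, hS] at h2
      rw [hS] at h1
      norm_num at h1 h2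
      linarith
    obtain ⟨y, z, hyz, hy, hz⟩ := hnode s hs
    obtain ⟨x', hx', f, hf, hg⟩ := A.exists_gain_split (V := V) (n := n + 1) (T := T) (by omega)
      (extend x n s) hyz (c := (k : ℝ) / 6) (fun a ha => by
        have ha' : HasTree (3 * k) {f ∈ V | f s = a} := by
          rcases ha with rfl | rfl
          exacts [hy, hz]
        obtain ⟨x', hx', f, hf, hg⟩ := ih ha' (n := n + 1 + 1) (by omega)
          (extend (extend x n s) (n + 1) a)
        exact ⟨x', hx', f, hf.1, by simpa using hf.2, hg⟩)
    refine ⟨x', eq_of_extend hx', f, hf, ?_⟩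
    rw [A.gain_eq_add f (by omega) hx']
    have := stepLoss_le_one f (extend x n s) n
    push_cast
    linarith

theorem Learner.gain_le_regret (A : Learner X) {F : Set (X → X)} {f : X → X} (hf : f ∈ F) (T : ℕ)
    (x : ℕ → X) : A.gain f x 0 T ≤ markovRegret A F T := by
  refine le_trans ?_ (le_ciSup (bddAbove_regret A F T) x)
  have h : (bestLoss F T x : ℝ) ≤ markovLoss f T x := by exact_mod_cast bestLoss_le hf T x
  rw [markovLoss_eq_sum] at h
  rw [A.expectedLoss_eq_sum, Learner.gain, Finset.sum_sub_distrib, Nat.Ico_zero_eq_range]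
  linarith

theorem Learner.div_le_markovRegret (A : Learner X) [Nonempty X] {F : Set (X → X)} {d T : ℕ}
    (hF : HasTree d F) (hdT : d ≤ T) : (d : ℝ) / 18 ≤ markovRegret A F T := by
  rcases Nat.eq_zero_or_pos d with rfl | hpos
  · obtain ⟨x', -, f, hf, hg⟩ := A.exists_gain_of_hasTree (T := T) 0 hF (n := 0) (by omega)
      (fun _ => Classical.arbitrary X)
    simpa using hg.trans (A.gain_le_regret hf T x')
  obtain ⟨k, hk, hk'⟩ : ∃ k, 3 * k + 1 ≤ d ∧ d ≤ 3 * k + 3 := ⟨(d - 1) / 3, by omega, by omega⟩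
  obtain ⟨s, y, z, hyz, hy, hz⟩ := hF.of_le hk
  obtain ⟨x', -, f, hf, hg⟩ := A.exists_gain_split (V := F) (n := 0) (T := T) (by omega)
    (fun _ => s) hyz (c := (k : ℝ) / 6) (fun a ha => by
      have ha' : HasTree (3 * k) {f ∈ F | f s = a} := by
        rcases ha with rfl | rfl
        exacts [hy, hz]
      obtain ⟨x', hx', f, hf, hg⟩ := A.exists_gain_of_hasTree k ha' (n := 0 + 1) (T := T) (by omega)
        (extend (fun _ => s) 0 a)
      exact ⟨x', hx', f, hf.1, hf.2, hg⟩)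
  have h1 := hg.trans (A.gain_le_regret hf T x')
  have h2 : (d : ℝ) ≤ 3 * k + 3 := by exact_mod_cast hk'
  linarith

/-! ### The square-root lower bound -/

/-- A polynomial lower bound for half the expected value of `|D'|`, where `D'` is the difference of
the losses of `f` and `g` after `n` more rounds of the random walk behind
`Learner.exists_le_gain_pair`, and `D` is the present difference.  Here `δ = 0` if `f` and `g`
differ at the present state and `δ = 2 / 3` if they agree there, so that `D ^ 2 + (n / 3 - δ)`
bounds the second moment of `D'` from below; `D ^ 4 + 6 * n * D ^ 2 + 3 * n ^ 2` bounds the fourth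
moment from above.  Moments enter through `2 * |D'| ≥ 3 * κ * D' ^ 2 - κ ^ 3 * D' ^ 4`. -/
noncomputable def walkPotential (κ : ℝ) (n : ℕ) (δ D : ℝ) : ℝ :=
  (3 * κ * (D ^ 2 + (n / 3 - δ)) - κ ^ 3 * (D ^ 4 + 6 * n * D ^ 2 + 3 * n ^ 2)) / 4

theorem walkPotential_antitone {κ : ℝ} (hκ : 0 ≤ κ) (n : ℕ) {δ δ' : ℝ} (h : δ ≤ δ') (D : ℝ) :
    walkPotential κ n δ' D ≤ walkPotential κ n δ D := by
  unfold walkPotential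
  nlinarith [mul_nonneg hκ (sub_nonneg.2 h)]

theorem walkPotential_zero_le {κ : ℝ} (hκ : 0 ≤ κ) {δ : ℝ} (hδ : 0 ≤ δ) (D : ℝ) :
    walkPotential κ 0 δ D ≤ |D| / 2 := by
  refine (walkPotential_antitone hκ 0 hδ D).trans ?_
  have h : walkPotential κ 0 0 D = (3 * (κ * |D|) - (κ * |D|) ^ 3) * |D| / 4 := by
    have h2 : |D| ^ 2 = D ^ 2 := sq_abs D
    have h4 : |D| ^ 4 = D ^ 4 := by rw [show |D| ^ 4 = (|D| ^ 2) ^ 2 by ring, h2]; ring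
    unfold walkPotential
    push_cast
    rw [← h2, ← h4]
    ring
  rw [h]
  -- The AM-GM inequality `3 * v ≤ 2 + v ^ 3`.
  have hv : ∀ v : ℝ, 0 ≤ v → 3 * v - v ^ 3 ≤ 2 := fun v hv => by
    nlinarith [mul_nonneg (sq_nonneg (v - 1)) (by linarith : (0 : ℝ) ≤ v + 2)]
  nlinarith [mul_le_mul_of_nonneg_right (hv (κ * |D|) (by positivity)) (abs_nonneg D)]

theorem walkPotential_split {κ : ℝ} (hκ : 0 ≤ κ) (n : ℕ) (D : ℝ) :
    walkPotential κ (n + 1) 0 D ≤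
      (walkPotential κ n (2 / 3) (D - 1) + walkPotential κ n (2 / 3) (D + 1)) / 2 := by
  have h : 0 ≤ κ ^ 3 := by positivity
  unfold walkPotential
  push_cast
  nlinarith

theorem walkPotential_agree {κ : ℝ} (hκ : 0 ≤ κ) (n : ℕ) (D : ℝ) :
    walkPotential κ (n + 1) (2 / 3) D ≤
      (walkPotential κ n (2 / 3) D + walkPotential κ n 0 D) / 2 := by
  have h : 0 ≤ κ ^ 3 := by positivity
  have h1 := mul_nonneg h (sq_nonneg D)
  have h2 := mul_nonneg h (Nat.cast_nonneg (α := ℝ) n)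
  unfold walkPotential
  push_cast
  nlinarith

theorem walkPotential_agree_stay {κ : ℝ} (hκ : 0 ≤ κ) (n : ℕ) (D : ℝ) :
    walkPotential κ (n + 1) (2 / 3) D ≤ walkPotential κ n 0 D := by
  have h := walkPotential_antitone hκ n (show (0 : ℝ) ≤ 2 / 3 by norm_num) D
  linarith [walkPotential_agree hκ n D]

open Classical in
/-- Two functions `f`, `g` that differ at `x₀` force regret.  The adversary derandomizes the
following walk: where `f` and `g` differ, move to either of their values with probability `1 / 2`;
where they agree, move to their common value or back to `x₀` with probability `1 / 2`.  In each
round the learner's expected loss is at least the average of those of `f` and `g`, and the maximum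
of the two regrets exceeds their average by half the absolute difference of the losses. -/
theorem Learner.exists_le_gain_pair (A : Learner X) {f g : X → X} {x₀ : X} (hfg : f x₀ ≠ g x₀)
    {κ : ℝ} (hκ : 0 ≤ κ) {T : ℕ} (m : ℕ) {n : ℕ} (hn : n + m = T) (x : ℕ → X) (D : ℝ) :
    ∃ x' : ℕ → X, (∀ i ≤ n, x' i = x i) ∧
      walkPotential κ m (if f (x n) = g (x n) then 2 / 3 else 0) D ≤
        (A.gain f x' n T + A.gain g x' n T) / 2 +
          |D + A.gain g x' n T - A.gain f x' n T| / 2 := by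
  induction m generalizing n x D with
  | zero =>
    refine ⟨x, fun _ _ => rfl, ?_⟩
    have : n = T := by omega
    subst this
    simp only [Learner.gain, Finset.Ico_self, Finset.sum_empty]
    have := walkPotential_zero_le hκ
      (show (0 : ℝ) ≤ if f (x n) = g (x n) then 2 / 3 else 0 by split_ifs <;> norm_num) D
    simpa using this
  | succ m ih =>
    have step : ∀ a : X, ∃ x' : ℕ → X, (∀ i ≤ n, x' i = x i) ∧
        A.missProb (extend x n a) n -
            (stepLoss f (extend x n a) n + stepLoss g (extend x n a) n) / 2 +
          walkPotential κ m (if f a = g a then 2 / 3 else 0)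
            (D + stepLoss f (extend x n a) n - stepLoss g (extend x n a) n) ≤
        (A.gain f x' n T + A.gain g x' n T) / 2 +
          |D + A.gain g x' n T - A.gain f x' n T| / 2 := by
      intro a
      obtain ⟨x', hx', h⟩ := ih (n := n + 1) (by omega) (extend x n a)
        (D + stepLoss f (extend x n a) n - stepLoss g (extend x n a) n)
      refine ⟨x', eq_of_extend hx', ?_⟩
      rw [A.gain_eq_add f (by omega) hx', A.gain_eq_add g (by omega) hx']
      rw [extend_succ] at h
      ring_nf at h ⊢
      linarith
    have hδ : ∀ (a : X) (E : ℝ), walkPotential κ m (2 / 3) E ≤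
        walkPotential κ m (if f a = g a then 2 / 3 else 0) E := fun a E =>
      walkPotential_antitone hκ m (by split_ifs <;> norm_num) E
    -- It suffices that the bound holds on average over two continuations, possibly equal.
    suffices h : ∃ a b : X, walkPotential κ (m + 1) (if f (x n) = g (x n) then 2 / 3 else 0) D ≤
        ((A.missProb (extend x n a) n -
            (stepLoss f (extend x n a) n + stepLoss g (extend x n a) n) / 2 +
          walkPotential κ m (if f a = g a then 2 / 3 else 0)
            (D + stepLoss f (extend x n a) n - stepLoss g (extend x n a) n)) +
        (A.missProb (extend x n b) n -
            (stepLoss f (extend x n b) n + stepLoss g (extend x n b) n) / 2 +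
          walkPotential κ m (if f b = g b then 2 / 3 else 0)
            (D + stepLoss f (extend x n b) n - stepLoss g (extend x n b) n))) / 2 by
      obtain ⟨a, b, h⟩ := h
      obtain ⟨xa, hxa, ha⟩ := step a
      obtain ⟨xb, hxb, hb⟩ := step b
      rcases le_total (A.missProb (extend x n a) n -
            (stepLoss f (extend x n a) n + stepLoss g (extend x n a) n) / 2 +
          walkPotential κ m (if f a = g a then 2 / 3 else 0)
            (D + stepLoss f (extend x n a) n - stepLoss g (extend x n a) n))
        (A.missProb (extend x n b) n -
            (stepLoss f (extend x n b) n + stepLoss g (extend x n b) n) / 2 +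
          walkPotential κ m (if f b = g b then 2 / 3 else 0)
            (D + stepLoss f (extend x n b) n - stepLoss g (extend x n b) n)) with hab | hab
      · exact ⟨xb, hxb, by linarith⟩
      · exact ⟨xa, hxa, by linarith⟩
    by_cases hs : f (x n) = g (x n)
    · rw [if_pos hs]
      by_cases hc : f (x n) = x₀
      · refine ⟨x₀, x₀, ?_⟩
        rw [stepLoss_of_eq (by simpa using hc), stepLoss_of_eq (by simpa [← hs] using hc),
          if_neg hfg]
        have h1 := A.missProb_nonneg (extend x n x₀) n
        have h2 := walkPotential_agree_stay hκ m D
        simp only [add_zero, sub_zero, zero_div]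
        linarith
      · refine ⟨f (x n), x₀, ?_⟩
        rw [stepLoss_of_eq (f := f) (x := extend x n (f (x n))) (by simp),
          stepLoss_of_eq (f := g) (x := extend x n (f (x n))) (by simp [hs]),
          stepLoss_of_ne (f := f) (x := extend x n x₀) (by simpa using hc),
          stepLoss_of_ne (f := g) (x := extend x n x₀) (by simpa [← hs] using hc), if_neg hfg]
        have h1 := A.one_le_missProb_add x n hc
        have h2 := walkPotential_agree hκ m D
        have h3 := hδ (f (x n)) D
        simp only [add_zero, sub_zero, zero_div, add_sub_cancel_right]
        linarith
    · rw [if_neg hs]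
      refine ⟨f (x n), g (x n), ?_⟩
      rw [stepLoss_of_eq (f := f) (x := extend x n (f (x n))) (by simp),
        stepLoss_of_ne (f := g) (x := extend x n (f (x n))) (by simpa using Ne.symm hs),
        stepLoss_of_ne (f := f) (x := extend x n (g (x n))) (by simpa using hs),
        stepLoss_of_eq (f := g) (x := extend x n (g (x n))) (by simp)]
      have h1 := A.one_le_missProb_add x n hs
      have h2 := walkPotential_split hκ m D
      have h3 := hδ (f (x n)) (D - 1)
      have h4 := hδ (g (x n)) (D + 1)
      simp only [add_zero, sub_zero, zero_add]
      linarith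

theorem Learner.sqrt_le_markovRegret (A : Learner X) {F : Set (X → X)} (hF : F.Nontrivial)
    (T : ℕ) : Real.sqrt T / 18 ≤ markovRegret A F T := by
  obtain ⟨f, hf, g, hg, hne⟩ := hF
  obtain ⟨x₀, hx₀⟩ := Function.ne_iff.1 hne
  -- This `κ` maximizes `walkPotential κ T 0 0`; it is `0` for `T = 0`, where the bound is trivial.
  obtain ⟨x', -, h⟩ := A.exists_le_gain_pair hx₀ (κ := (3 * Real.sqrt T)⁻¹) (by positivity) T
    (zero_add T) (fun _ => x₀) 0
  have hf' := A.gain_le_regret hf T x'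
  have hg' := A.gain_le_regret hg T x'
  have hpot : walkPotential (3 * Real.sqrt T)⁻¹ T 0 0 = Real.sqrt T / 18 := by
    rcases Nat.eq_zero_or_pos T with rfl | hT
    · simp [walkPotential]
    · have hs : 0 < Real.sqrt T := Real.sqrt_pos.2 (by exact_mod_cast hT)
      have hsq : (T : ℝ) = Real.sqrt T ^ 2 := (Real.sq_sqrt (Nat.cast_nonneg T)).symm
      unfold walkPotential
      rw [show ((T : ℕ) : ℝ) = Real.sqrt T ^ 2 from hsq, Real.sqrt_sq hs.le]
      field_simp
      ring
  rw [if_neg hx₀, hpot] at h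
  refine h.trans ?_
  rcases abs_cases (0 + A.gain g x' 0 T - A.gain f x' 0 T) with ⟨h1, -⟩ | ⟨h1, -⟩ <;>
    rw [h1] <;> linarith

/-! ### Exponential weights and randomized learners -/

/-- Hoeffding's lemma for a finite distribution. -/
theorem sum_mul_exp_neg_le {ι : Type*} [Fintype ι] (p : PMF ι) {l : ι → ℝ}
    (hl : ∀ i, l i ∈ Set.Icc (0 : ℝ) 1) (η : ℝ) :
    ∑ i, (p i).toReal * Real.exp (-η * l i) ≤
      Real.exp (-η * ∑ i, (p i).toReal * l i + η ^ 2 / 8) := by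
  let _ : MeasurableSpace ι := ⊤
  have h := (ProbabilityTheory.hasSubgaussianMGF_of_mem_Icc (μ := p.toMeasure) (X := l)
    (a := 0) (b := 1) (measurable_from_top.aemeasurable) (Eventually.of_forall hl)).mgf_le (-η)
  simp only [ProbabilityTheory.mgf, PMF.integral_eq_sum, smul_eq_mul] at h
  set q := ∑ i, (p i).toReal * l i
  have h1 : ∑ i, (p i).toReal * Real.exp (-η * (l i - q)) =
      Real.exp (η * q) * ∑ i, (p i).toReal * Real.exp (-η * l i) := by
    rw [Finset.mul_sum]
    refine Finset.sum_congr rfl fun i _ => ?_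
    rw [show -η * (l i - q) = η * q + -η * l i by ring, Real.exp_add]
    ring
  rw [h1] at h
  have h2 := mul_le_mul_of_nonneg_left h (Real.exp_nonneg (-η * q))
  rw [← mul_assoc, ← Real.exp_add, ← Real.exp_add] at h2
  norm_num at h2
  have h3 : -(η * q) + 1 / 4 * η ^ 2 / 2 = -η * q + η ^ 2 / 8 := by ring
  rw [h3] at h2
  simpa only [neg_mul] using h2

section Hedge

variable {ι : Type*} [Fintype ι] [Nonempty ι]

/-- Exponential weights: the distribution on the experts in which `i`, with cumulative loss `L i`,
has probability proportional to `exp (-η * L i)`. -/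
noncomputable def hedge (η : ℝ) (L : ι → ℝ) : PMF ι :=
  PMF.normalize (fun i => ENNReal.ofReal (Real.exp (-η * L i)))
    (by
      rw [tsum_fintype]
      simp [Finset.sum_eq_zero_iff, Real.exp_pos])
    (by
      rw [tsum_fintype]
      exact ENNReal.sum_ne_top.2 fun _ _ => ENNReal.ofReal_ne_top)

theorem hedge_apply (η : ℝ) (L : ι → ℝ) (i : ι) :
    (hedge η L i).toReal = Real.exp (-η * L i) / ∑ j, Real.exp (-η * L j) := by
  rw [hedge, PMF.normalize_apply, tsum_fintype,
    ← ENNReal.ofReal_sum_of_nonneg fun j _ => (Real.exp_pos _).le, ENNReal.toReal_mul,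
    ENNReal.toReal_inv, ENNReal.toReal_ofReal (Real.exp_pos _).le,
    ENNReal.toReal_ofReal (Finset.sum_nonneg fun j _ => (Real.exp_pos _).le), div_eq_mul_inv]

/-- Regret bound for exponential weights against every single expert. -/
theorem sum_hedge_le {η : ℝ} (hη : 0 < η) (l : ℕ → ι → ℝ)
    (hl : ∀ t i, l t i ∈ Set.Icc (0 : ℝ) 1) (T : ℕ) (j : ι) :
    ∑ t ∈ Finset.range T, ∑ i, (hedge η (fun i => ∑ s ∈ Finset.range t, l s i) i).toReal * l t i ≤
      ∑ t ∈ Finset.range T, l t j + Real.log (Fintype.card ι) / η + η * T / 8 := by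
  set L : ℕ → ι → ℝ := fun t i => ∑ s ∈ Finset.range t, l s i with hL
  set W : ℕ → ℝ := fun t => ∑ i, Real.exp (-η * L t i) with hW
  have hWpos : ∀ t, 0 < W t := fun t =>
    Finset.sum_pos (fun i _ => Real.exp_pos _) Finset.univ_nonempty
  have hstep : ∀ t, Real.log (W (t + 1)) ≤ Real.log (W t) +
      (-η * ∑ i, (hedge η (L t) i).toReal * l t i + η ^ 2 / 8) := by
    intro t
    have h1 : W (t + 1) = W t * ∑ i, (hedge η (L t) i).toReal * Real.exp (-η * l t i) := by
      rw [Finset.mul_sum]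
      refine Finset.sum_congr rfl fun i _ => ?_
      have h2 : L (t + 1) i = L t i + l t i := Finset.sum_range_succ _ _
      have h3 := (hWpos t).ne'
      simp only [hW] at h3
      rw [hedge_apply, h2, mul_add, Real.exp_add]
      simp only [hW]
      field_simp
    rw [h1, ← Real.log_exp (-η * _ + _), ← Real.log_mul (hWpos t).ne' (Real.exp_pos _).ne']
    refine Real.log_le_log (h1 ▸ hWpos (t + 1)) ?_
    exact mul_le_mul_of_nonneg_left (sum_mul_exp_neg_le _ (hl t) η) (hWpos t).le
  -- Compare the logarithm of the final total weight with the weight of the single expert `j`.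
  have hsum : Real.log (W T) ≤ Real.log (Fintype.card ι) +
      ∑ t ∈ Finset.range T, (-η * ∑ i, (hedge η (L t) i).toReal * l t i + η ^ 2 / 8) := by
    induction T with
    | zero => simp [hW, hL]
    | succ T ih =>
      rw [Finset.sum_range_succ]
      linarith [hstep T]
  have hlow : -η * L T j ≤ Real.log (W T) := by
    rw [← Real.log_exp (-η * L T j)]
    exact Real.log_le_log (Real.exp_pos _)
      (Finset.single_le_sum (f := fun i => Real.exp (-η * L T i)) (fun i _ => (Real.exp_pos _).le)
        (Finset.mem_univ j))
  rw [Finset.sum_add_distrib, ← Finset.mul_sum, Finset.sum_const, Finset.card_range,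
    nsmul_eq_mul] at hsum
  have h4 := hlow.trans hsum
  rw [← sub_nonneg]
  have h5 : 0 ≤ (Real.log (Fintype.card ι) +
      (-η * ∑ t ∈ Finset.range T, ∑ i, (hedge η (L t) i).toReal * l t i + T * (η ^ 2 / 8)) -
      -η * L T j) / η := div_nonneg (sub_nonneg.2 h4) hη.le
  convert h5 using 1
  simp only [hL]
  field_simp
  ring

end Hedge

/-- A learner that follows random advice: on every history it draws an expert from the
distribution `q` and repeats its prediction.  The draws on different histories are independent, so
the sample space is a product over all histories; `ULift` places it in the universe of `X`. -/
noncomputable def Learner.ofAdvice {ι : Type} [Fintype ι]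
    (e : (t : ℕ) → (Fin t → X) → ι → X) (q : (t : ℕ) → (Fin t → X) → PMF ι) : Learner X where
  Ω := (Σ t : ℕ, (Fin t → X)) → ULift.{u} ι
  mΩ := @MeasurableSpace.pi _ _ fun _ => ⊤
  μ := @Measure.infinitePi _ _ (fun _ => ⊤) fun h =>
    @PMF.toMeasure (ULift.{u} ι) ⊤ ((q h.1 h.2).map ULift.up)
  prob := by
    let _ : MeasurableSpace (ULift.{u} ι) := ⊤
    exact inferInstance
  predict t h ω := e t h (ω ⟨t, h⟩).down
  measurableSet_predict t h x := by
    let _ : MeasurableSpace (ULift.{u} ι) := ⊤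
    exact measurable_pi_apply (X := fun _ : Σ t : ℕ, (Fin t → X) => ULift.{u} ι) ⟨t, h⟩
      (MeasurableSpace.measurableSet_top (s := {i : ULift.{u} ι | e t h i.down = x}))

open Classical in
theorem Learner.missProb_ofAdvice {ι : Type} [Fintype ι]
    (e : (t : ℕ) → (Fin t → X) → ι → X) (q : (t : ℕ) → (Fin t → X) → PMF ι) (x : ℕ → X) (t : ℕ) :
    (Learner.ofAdvice e q).missProb x t =
      ∑ i, (q (t + 1) (fun j => x j) i).toReal *
        if e (t + 1) (fun j => x j) i ≠ x (t + 1) then 1 else 0 := by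
  let _ : MeasurableSpace (ULift.{u} ι) := ⊤
  let _ : MeasurableSpace ι := ⊤
  set h : Σ t : ℕ, (Fin t → X) := ⟨t + 1, fun j => x j⟩ with hh
  set ν : (Σ t : ℕ, (Fin t → X)) → Measure (ULift.{u} ι) :=
    fun h => ((q h.1 h.2).map ULift.up).toMeasure with hν
  set S : Set ι := {i | e (t + 1) (fun j => x j) i ≠ x (t + 1)} with hS
  have h1 : (Learner.ofAdvice e q).missProb x t =
      (Measure.infinitePi ν).real ((fun ω => ω h) ⁻¹' (ULift.down ⁻¹' S)) := rfl
  have h2 : (Measure.infinitePi ν).real ((fun ω => ω h) ⁻¹' (ULift.down ⁻¹' S)) =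
      (ν h).real (ULift.down ⁻¹' S) := by
    rw [measureReal_def, measureReal_def, ← Measure.map_apply (measurable_pi_apply h)
      MeasurableSpace.measurableSet_top]
    congr 2
    exact Measure.infinitePi_map_eval ν h
  have h3 : (ν h).real (ULift.down ⁻¹' S) = ((q h.1 h.2).toMeasure).real S := by
    have hm : Measurable (ULift.up : ι → ULift.{u} ι) := measurable_from_top
    rw [measureReal_def, measureReal_def, hν]
    simp only
    rw [← PMF.toMeasure_map _ _ hm, Measure.map_apply hm MeasurableSpace.measurableSet_top]
    rfl
  rw [h1, h2, h3, ← integral_indicator_one MeasurableSpace.measurableSet_top, PMF.integral_eq_sum]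
  simp only [Set.indicator_apply, hS, Set.mem_ofPred_eq, Pi.one_apply, smul_eq_mul]
  rfl

open Classical in
/-- Number of mistakes made by an expert with predictions `e` in the rounds `1, …, t` on the history
`h 0, …, h t`.  As in `Learner.predict`, `e t` receives the first `t` states. -/
noncomputable def pastLoss (e : (t : ℕ) → (Fin t → X) → X) (t : ℕ) (h : Fin (t + 1) → X) : ℝ :=
  ∑ s : Fin t, if e (s + 1) (fun j => h (Fin.castLE (Nat.succ_le_succ s.2.le) j)) ≠ h s.succ
    then 1 else 0

open Classical in
/-- Prediction with expert advice: a randomized learner competes with the best of finitely many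
experts, each of which may depend on the history. -/
theorem exists_learner_le_expert {ι : Type} [Fintype ι] [Nonempty ι]
    (e : (t : ℕ) → (Fin t → X) → ι → X) {η : ℝ} (hη : 0 < η) (T : ℕ) :
    ∃ A : Learner X, ∀ (x : ℕ → X) (j : ι), A.expectedLoss T x ≤
      (∑ t ∈ Finset.range T, if e (t + 1) (fun i => x i) j ≠ x (t + 1) then 1 else 0) +
        Real.log (Fintype.card ι) / η + η * T / 8 := by
  refine ⟨Learner.ofAdvice e fun t => match t with
    | 0 => fun _ => hedge η 0
    | t + 1 => fun h => hedge η fun i => pastLoss (fun t h => e t h i) t h, fun x j => ?_⟩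
  have h := sum_hedge_le hη (fun t i => if e (t + 1) (fun j => x j) i ≠ x (t + 1) then 1 else 0)
    (fun t i => by split_ifs <;> simp) T j
  refine le_trans (le_of_eq ?_) h
  rw [Learner.expectedLoss_eq_sum]
  refine Finset.sum_congr rfl fun t _ => ?_
  rw [Learner.missProb_ofAdvice]
  have hp : (fun i => pastLoss (fun t h => e t h i) t fun j => x j) = fun i =>
      ∑ s ∈ Finset.range t, if e (s + 1) (fun j => x j) i ≠ x (s + 1) then (1 : ℝ) else 0 :=
    funext fun i => Fin.sum_univ_eq_sum_range
      (fun s => if e (s + 1) (fun j => x j) i ≠ x (s + 1) then (1 : ℝ) else 0) t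
  simp only [hp]

/-! ### Experts from the standard optimal algorithm, and the upper bound -/

/-- The functions in `F` that agree with the observed transitions of the rounds in `I`. -/
def versionSpace (F : Set (X → X)) (I : Finset ℕ) (t : ℕ) (h : Fin (t + 1) → X) : Set (X → X) :=
  {f ∈ F | ∀ s : Fin t, (s : ℕ) ∈ I → f (h s.castSucc) = h s.succ}

open Classical in
/-- The standard optimal algorithm, restricted to learn from the rounds in `I` only: it predicts a
label whose subclass of the version space retains the full remaining tree depth, which starts at
`d` and is lowered by `1` in each round of `I`.  There is at most one such label as long as the
version space has no tree of larger depth; without one the prediction is irrelevant. -/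
noncomputable def soa (F : Set (X → X)) (d : ℕ) (I : Finset ℕ) (t : ℕ) (h : Fin (t + 1) → X) : X :=
  if hy : ∃ y, HasTree (d - (I.filter (· < t)).card)
      {f ∈ versionSpace F I t h | f (h (Fin.last t)) = y}
  then hy.choose else h (Fin.last t)

theorem versionSpace_congr (F : Set (X → X)) {I J : Finset ℕ} {t : ℕ}
    (hIJ : ∀ s < t, s ∈ I ↔ s ∈ J) (h : Fin (t + 1) → X) :
    versionSpace F I t h = versionSpace F J t h := by
  ext f
  simp only [versionSpace, Set.mem_ofPred_eq, hIJ _ (Fin.is_lt _)]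

theorem soa_congr (F : Set (X → X)) (d : ℕ) {I J : Finset ℕ} {t : ℕ}
    (hIJ : ∀ s < t, s ∈ I ↔ s ∈ J) (h : Fin (t + 1) → X) : soa F d I t h = soa F d J t h := by
  have h1 : I.filter (· < t) = J.filter (· < t) := by
    ext s
    simp only [Finset.mem_filter]
    exact and_congr_left (hIJ s)
  rw [soa, soa, versionSpace_congr F hIJ, h1]

theorem mem_versionSpace_stream {F : Set (X → X)} {I : Finset ℕ} {t : ℕ} {x : ℕ → X} {f : X → X} :
    f ∈ versionSpace F I t (fun i => x i) ↔ f ∈ F ∧ ∀ s < t, s ∈ I → f (x s) = x (s + 1) :=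
  and_congr_right fun _ => ⟨fun h s hs hI => h ⟨s, hs⟩ hI, fun h s hI => h s s.2 hI⟩

/-- For every `f ∈ F` some choice of at most `d` update rounds makes `soa` correct in all other
rounds in which `f` is correct: update exactly in the rounds where `f` is correct and `soa` errs,
each of which lowers the tree depth of the version space. -/
theorem exists_update_rounds {F : Set (X → X)} {d : ℕ} (hd : ¬ HasTree (d + 1) F) {f : X → X}
    (hf : f ∈ F) (x : ℕ → X) (n : ℕ) :
    ∃ I ⊆ Finset.range n, I.card ≤ d ∧ (∀ s ∈ I, f (x s) = x (s + 1)) ∧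
      ¬ HasTree (d - I.card + 1) (versionSpace F I n fun i => x i) ∧
      ∀ t < n, f (x t) = x (t + 1) → t ∉ I → soa F d I t (fun i => x i) = x (t + 1) := by
  induction n with
  | zero =>
    refine ⟨∅, Finset.empty_subset _, by simp, by simp, fun h => hd ?_, by simp⟩
    exact h.mono fun g hg => hg.1
  | succ n ih =>
    obtain ⟨I, hI, hcard, hfI, htree, hsoa⟩ := ih
    by_cases hok : f (x n) = x (n + 1) → soa F d I n (fun i => x i) = x (n + 1)
    · refine ⟨I, hI.trans (Finset.range_mono n.le_succ), hcard, hfI, fun h => htree ?_, ?_⟩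
      · refine h.mono fun g hg => ?_
        rw [mem_versionSpace_stream] at hg ⊢
        exact ⟨hg.1, fun s hs => hg.2 s (hs.trans n.lt_succ_self)⟩
      · intro t ht hft htI
        rcases Nat.lt_succ_iff_lt_or_eq.1 ht with ht | rfl
        · exact hsoa t ht hft htI
        · exact hok hft
    · push Not at hok
      obtain ⟨hfn, hne⟩ := hok
      have hnI : n ∉ I := fun h => lt_irrefl n (Finset.mem_range.1 (hI h))
      have hfilter : I.filter (· < n) = I :=
        Finset.filter_true_of_mem fun s hs => Finset.mem_range.1 (hI hs)
      have hsub : ¬ HasTree (d - I.card)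
          {g ∈ versionSpace F I n (fun i => x i) | g (x n) = x (n + 1)} := by
        intro h
        have hy : ∃ y, HasTree (d - (I.filter (· < n)).card)
            {g ∈ versionSpace F I n (fun i => x i) | g (x n) = y} := ⟨_, by rwa [hfilter]⟩
        have hchoose : soa F d I n (fun i => x i) = hy.choose := dif_pos hy
        have hspec := hy.choose_spec
        rw [← hchoose, hfilter] at hspec
        exact htree ⟨x n, _, _, hne, hspec, h⟩
      have hpos : I.card < d := by
        by_contra hcon
        rw [Nat.sub_eq_zero_of_le (not_lt.1 hcon)] at hsub
        exact hsub ⟨f, mem_versionSpace_stream.2 ⟨hf, fun s _ hs => hfI s hs⟩, hfn⟩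
      have hins : ∀ t ≤ n, ∀ s < t, s ∈ insert n I ↔ s ∈ I := fun t ht s hs => by
        simp [(hs.trans_le ht).ne]
      refine ⟨insert n I, ?_, ?_, ?_, ?_, ?_⟩
      · intro s hs
        rcases Finset.mem_insert.1 hs with rfl | hs
        · simp
        · exact Finset.range_mono n.le_succ (hI hs)
      · rwa [Finset.card_insert_of_notMem hnI]
      · intro s hs
        rcases Finset.mem_insert.1 hs with rfl | hs
        exacts [hfn, hfI s hs]
      · intro h
        rw [Finset.card_insert_of_notMem hnI, show d - (I.card + 1) + 1 = d - I.card by omega] at h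
        refine hsub (h.mono fun g hg => ?_)
        rw [mem_versionSpace_stream] at hg
        exact ⟨mem_versionSpace_stream.2 ⟨hg.1, fun s hs hsI =>
          hg.2 s (hs.trans n.lt_succ_self) (Finset.mem_insert_of_mem hsI)⟩,
          hg.2 n n.lt_succ_self (Finset.mem_insert_self n I)⟩
      · intro t ht hft htI
        rw [Finset.mem_insert, not_or] at htI
        have ht' : t < n := lt_of_le_of_ne (Nat.lt_succ_iff.1 ht) htI.1
        rw [soa_congr F d (hins t ht'.le)]
        exact hsoa t ht' hft htI.2

/-- The set of update rounds encoded by `φ`.  The rounds being `0, …, T - 1`, the value `T` stands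
for no round; maps `Fin d → Fin (T + 1)` thus encode all sets of at most `d` rounds. -/
def updateRounds {d T : ℕ} (φ : Fin d → Fin (T + 1)) : Finset ℕ :=
  Finset.univ.image fun i => (φ i : ℕ)

theorem exists_updateRounds {d T : ℕ} {I : Finset ℕ} (hI : I ⊆ Finset.range T)
    (hcard : I.card ≤ d) :
    ∃ φ : Fin d → Fin (T + 1), ∀ s < T, s ∈ updateRounds φ ↔ s ∈ I := by
  have hmem : ∀ i, I.orderEmbOfFin rfl i < T := fun i =>
    Finset.mem_range.1 (hI (Finset.orderEmbOfFin_mem I rfl i))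
  refine ⟨fun i => if h : (i : ℕ) < I.card
    then ⟨I.orderEmbOfFin rfl ⟨i, h⟩, (hmem _).trans T.lt_succ_self⟩ else Fin.last T,
    fun s hs => ?_⟩
  simp only [updateRounds, Finset.mem_image, Finset.mem_univ, true_and]
  constructor
  · rintro ⟨i, rfl⟩
    by_cases h : (i : ℕ) < I.card
    · rw [dif_pos h]
      exact Finset.orderEmbOfFin_mem I rfl _
    · rw [dif_neg h] at hs
      exact absurd hs (lt_irrefl T)
  · intro h
    have hr : s ∈ Set.range (I.orderEmbOfFin rfl) := by
      rw [Finset.range_orderEmbOfFin]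
      exact h
    obtain ⟨i, rfl⟩ := hr
    exact ⟨⟨i, i.2.trans_le hcard⟩, by rw [dif_pos i.2]⟩

theorem exists_markovLoss_eq_bestLoss {F : Set (X → X)} (hF : F.Nonempty) (T : ℕ) (x : ℕ → X) :
    ∃ f ∈ F, markovLoss f T x = bestLoss F T x := by
  have : Nonempty F := hF.to_subtype
  obtain ⟨f, hf⟩ := Nat.sInf_mem (Set.range_nonempty fun f : F => markovLoss f.1 T x)
  exact ⟨f.1, f.2, hf⟩

theorem minimaxRegret_le_of_not_hasTree [Nonempty X] {F : Set (X → X)} (hF : F.Nonempty) {d : ℕ}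
    (hd : ¬ HasTree (d + 1) F) (T : ℕ) {η : ℝ} (hη : 0 < η) :
    minimaxRegret F T ≤ d + d * Real.log (T + 1) / η + η * T / 8 := by
  classical
  obtain ⟨A, hA⟩ := exists_learner_le_expert (X := X) (ι := Fin d → Fin (T + 1))
    (fun t => match t with
      | 0 => fun _ _ => Classical.arbitrary X
      | t + 1 => fun h φ => soa F d (updateRounds φ) t h) hη T
  refine (ciInf_le (bddBelow_markovRegret hF T) A).trans (ciSup_le fun x => ?_)
  obtain ⟨f, hf, hbest⟩ := exists_markovLoss_eq_bestLoss hF T x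
  obtain ⟨I, hI, hcard, -, -, hsoa⟩ := exists_update_rounds hd hf x T
  obtain ⟨φ, hφ⟩ := exists_updateRounds hI hcard
  have h1 := hA x φ
  have h2 : (∑ t ∈ Finset.range T,
      if soa F d (updateRounds φ) t (fun i => x i) ≠ x (t + 1) then (1 : ℝ) else 0) ≤
      bestLoss F T x + d := by
    calc _ ≤ ∑ t ∈ Finset.range T, (stepLoss f x t + if t ∈ I then 1 else 0) := by
          refine Finset.sum_le_sum fun t ht => ?_
          have ht := Finset.mem_range.1 ht
          have h3 : 0 ≤ stepLoss f x t := by unfold stepLoss; split_ifs <;> norm_num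
          by_cases htI : t ∈ I
          · rw [if_pos htI]
            split_ifs <;> linarith
          · by_cases hft : f (x t) = x (t + 1)
            · rw [soa_congr F d (fun s hs => hφ s (hs.trans ht)), hsoa t ht hft htI]
              simpa [htI] using h3
            · rw [stepLoss_of_ne hft]
              split_ifs <;> norm_num
      _ = bestLoss F T x + I.card := by
          rw [Finset.sum_add_distrib, ← markovLoss_eq_sum, hbest, Finset.sum_ite_mem,
            Finset.inter_eq_right.2 hI]
          simp
      _ ≤ _ := by gcongr
  have h4 : Real.log (Fintype.card (Fin d → Fin (T + 1))) = d * Real.log (T + 1) := by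
    rw [Fintype.card_fun, Fintype.card_fin, Fintype.card_fin, Nat.cast_pow, Real.log_pow]
    push_cast
    rfl
  rw [h4] at h1
  have h5 := h1.trans (add_le_add_left (add_le_add_left h2 _) _)
  linarith

theorem minimaxRegret_le_rounds [Nonempty X] {F : Set (X → X)} (hF : F.Nonempty) (T : ℕ) :
    minimaxRegret F T ≤ T := by
  refine (ciInf_le (bddBelow_markovRegret hF T) (Classical.arbitrary _)).trans
    (ciSup_le fun x => ?_)
  have h1 := ((Classical.arbitrary (Learner X)).expectedLoss_mem T x).2
  have h2 : (0 : ℝ) ≤ bestLoss F T x := Nat.cast_nonneg _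
  linarith

/-- Optimization of the learning rate. -/
theorem le_sqrt_of_forall_pos {r B T : ℝ} (hB : 0 ≤ B) (hT : 0 ≤ T)
    (h : ∀ η : ℝ, 0 < η → r ≤ B / η + η * T / 8) : r ≤ Real.sqrt (B * T / 2) := by
  refine le_of_forall_pos_le_add fun ε hε => ?_
  set s := Real.sqrt (B * T / 2) with hs
  have hs0 : 0 ≤ s := Real.sqrt_nonneg _
  have hsq : s ^ 2 = B * T / 2 := Real.sq_sqrt (by positivity)
  rcases hT.eq_or_lt with rfl | hT
  · have h1 := h ((B + 1) / ε) (by positivity)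
    have h2 : B / ((B + 1) / ε) ≤ ε := by
      rw [div_div_eq_mul_div, div_le_iff₀ (by positivity)]
      nlinarith
    simp only [mul_zero, zero_div, add_zero] at h1
    linarith
  · -- `η = 4 * s / T` is optimal; the slack `ε` covers the case `s = 0`.
    have h1 := h (4 * (s + ε) / T) (by positivity)
    have h2 : B / (4 * (s + ε) / T) ≤ s / 2 := by
      rw [div_div_eq_mul_div, div_le_iff₀ (by positivity)]
      nlinarith [mul_nonneg hs0 hε.le]
    have h3 : 4 * (s + ε) / T * T / 8 = (s + ε) / 2 := by
      field_simp
      ring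
    linarith

theorem minimaxRegret_le_add_sqrt [Nonempty X] {F : Set (X → X)} (hF : F.Nonempty) {d : ℕ}
    (hd : ¬ HasTree (d + 1) F) (T : ℕ) :
    minimaxRegret F T ≤ d + Real.sqrt (T * d * Real.log T) := by
  have hlog0 : 0 ≤ Real.log T := Real.log_natCast_nonneg T
  -- In the case `T = 1 ≤ d` the square root vanishes and the bound `T` on the regret is needed.
  by_cases h1 : T = 1 ∧ 1 ≤ d
  · obtain ⟨rfl, hd1⟩ := h1
    have h2 := minimaxRegret_le_rounds hF 1
    have h3 : (1 : ℝ) ≤ d := by exact_mod_cast hd1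
    have h4 := Real.sqrt_nonneg ((1 : ℕ) * d * Real.log (1 : ℕ))
    push_cast at h2 h4 ⊢
    linarith
  have hlog : d * Real.log (T + 1) ≤ 2 * d * Real.log T := by
    rcases Nat.eq_zero_or_pos d with rfl | hdpos
    · simp
    rcases Nat.eq_zero_or_pos T with rfl | hT
    · simp
    have hT2 : (2 : ℝ) ≤ T := by exact_mod_cast (by omega : 2 ≤ T)
    have h2 : Real.log (T + 1) ≤ Real.log (T ^ 2) :=
      Real.log_le_log (by positivity) (by nlinarith)
    rw [Real.log_pow] at h2
    push_cast at h2
    nlinarith [mul_le_mul_of_nonneg_left h2 (Nat.cast_nonneg (α := ℝ) d)]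
  have h5 := le_sqrt_of_forall_pos (r := minimaxRegret F T - d) (B := 2 * d * Real.log T) (T := T)
    (by positivity) (Nat.cast_nonneg T) fun η hη => by
      have h6 := minimaxRegret_le_of_not_hasTree hF hd T hη
      have h7 : d * Real.log (T + 1) / η ≤ 2 * d * Real.log T / η := by gcongr
      linarith
  rw [show 2 * (d : ℝ) * Real.log T * T / 2 = T * d * Real.log T by ring] at h5
  linarith

/-! ### The minimax regret -/

theorem isLittleO_add_sqrt_mul_log (d : ℝ) :
    (fun T : ℕ => d + Real.sqrt (T * d * Real.log T)) =o[atTop] (fun T : ℕ => (T : ℝ)) := by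
  have hcast : Tendsto (fun T : ℕ => (T : ℝ)) atTop atTop := tendsto_natCast_atTop_atTop
  refine IsLittleO.add ?_ ?_
  · exact isLittleO_const_left.2 (Or.inr (tendsto_norm_atTop_atTop.comp hcast))
  · have hlog : (fun T : ℕ => d * Real.log T) =o[atTop] (fun T : ℕ => (T : ℝ)) :=
      (Real.isLittleO_log_id_atTop.comp_tendsto hcast).const_mul_left d
    rw [isLittleO_iff]
    intro c hc
    filter_upwards [(isLittleO_iff.1 hlog) (by positivity : (0 : ℝ) < c ^ 2)] with T hT
    have hT0 : (0 : ℝ) ≤ T := Nat.cast_nonneg T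
    rw [Real.norm_eq_abs, Real.norm_eq_abs, abs_of_nonneg hT0] at hT
    rw [Real.norm_eq_abs, Real.norm_eq_abs, abs_of_nonneg (Real.sqrt_nonneg _),
      abs_of_nonneg hT0]
    refine Real.sqrt_le_iff.2 ⟨by positivity, ?_⟩
    nlinarith [mul_le_mul_of_nonneg_left ((le_abs_self _).trans hT) hT0]

theorem div_le_minimaxRegret [Nonempty X] {F : Set (X → X)} (hF : F.Nonempty) (T : ℕ) :
    ((min (littlestoneDim F) (T : ℕ∞)).toNat : ℝ) / 18 ≤ minimaxRegret F T := by
  refine le_ciInf fun A => A.div_le_markovRegret (hasTree_of_le_littlestoneDim hF ?_) ?_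
  · exact (ENat.natCast_toNat_le_self _).trans (min_le_left _ _)
  · exact ENat.toNat_le_of_le_natCast (min_le_right _ _)

theorem sqrt_le_minimaxRegret [Nonempty X] {F : Set (X → X)} (hF : F.Nontrivial) (T : ℕ) :
    Real.sqrt T / (16 * Real.sqrt 3) ≤ minimaxRegret F T := by
  refine le_ciInf fun A => le_trans ?_ (A.sqrt_le_markovRegret hF T)
  have h3 : (9 / 8 : ℝ) ≤ Real.sqrt 3 := Real.le_sqrt_of_sq_le (by norm_num)
  exact div_le_div_of_nonneg_left (Real.sqrt_nonneg _) (by norm_num) (by linarith)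

theorem minimaxRegret_le_of_littlestoneDim_eq [Nonempty X] {F : Set (X → X)} (hF : F.Nonempty)
    {d : ℕ} (hd : littlestoneDim F = d) (T : ℕ) :
    minimaxRegret F T ≤ d + Real.sqrt (T * d * Real.log T) := by
  refine minimaxRegret_le_add_sqrt hF (fun h => ?_) T
  have := h.le_littlestoneDim
  rw [hd, Nat.cast_le] at this
  omega

theorem agnosticLearnable_iff [Nonempty X] {F : Set (X → X)} (hF : F.Nonempty) :
    AgnosticLearnable F ↔ littlestoneDim F < ⊤ := by
  constructor
  · intro h
    by_contra htop
    rw [not_lt_top_iff] at htop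
    have h1 := (isLittleO_iff.1 h) (show (0 : ℝ) < 1 / 36 by norm_num)
    obtain ⟨T, hT, hT1⟩ := (h1.and (eventually_ge_atTop 1)).exists
    have h2 := div_le_minimaxRegret hF T
    rw [htop, min_eq_right le_top, ENat.toNat_natCast] at h2
    have h3 : (1 : ℝ) ≤ T := by exact_mod_cast hT1
    rw [Real.norm_eq_abs, Real.norm_eq_abs, abs_of_nonneg (by linarith : (0 : ℝ) ≤ T)] at hT
    have h4 := le_abs_self (minimaxRegret F T)
    linarith
  · intro h
    obtain ⟨d, hd⟩ := ENat.ne_top_iff_exists.1 h.ne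
    refine IsBigO.trans_isLittleO (IsBigO.of_bound 1 (Eventually.of_forall fun T => ?_))
      (isLittleO_add_sqrt_mul_log d)
    have h0 : 0 ≤ minimaxRegret F T := le_trans (by positivity) (div_le_minimaxRegret hF T)
    rw [Real.norm_eq_abs, Real.norm_eq_abs, abs_of_nonneg h0, abs_of_nonneg (by positivity),
      one_mul]
    exact minimaxRegret_le_of_littlestoneDim_eq hF hd.symm T

end DynLearn

theorem theorem8 {X : Type*} [Nonempty X] (F : Set (X → X)) (hF : F.Nonempty) :
    (∀ T : ℕ,
      ((min (DynLearn.littlestoneDim F) (T : ℕ∞)).toNat : ℝ) / 18 ≤ DynLearn.minimaxRegret F T ∧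
      (F.Nontrivial → Real.sqrt T / (16 * Real.sqrt 3) ≤ DynLearn.minimaxRegret F T) ∧
      (∀ d : ℕ, DynLearn.littlestoneDim F = (d : ℕ∞) →
        DynLearn.minimaxRegret F T ≤ d + Real.sqrt (T * d * Real.log T))) ∧
    (DynLearn.AgnosticLearnable F ↔ DynLearn.littlestoneDim F < ⊤) :=
  ⟨fun T => ⟨DynLearn.div_le_minimaxRegret hF T, fun h => DynLearn.sqrt_le_minimaxRegret h T,
    fun _ hd => DynLearn.minimaxRegret_le_of_littlestoneDim_eq hF hd T⟩,
    DynLearn.agnosticLearnable_iff hF⟩
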